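/- A dag is a finite directed graph without directed cycles. For a directed graph $G$ on $[n]$ and a permutation $\pi$ of $[n]$, let $G_L(\pi)$ be the spanning subgraph of $G$ consisting of the edges $(i,j)$ with $\pi(i)<\pi(j)$. For a dag $H$, an $H$-copy of $G$ is a subgraph of $G$ isomorphic to $H$; it is covered by $\pi$ if it is a subgraph of $G_L(\pi)$. Let $\tau(H,G)$ be the smallest $t$ for which there are permutations $\pi_1,\dots,\pi_t$ of $[n]$ such that every $H$-copy of $G$ is covered by at least one $\pi_i$. Let $\vec G(n,p)$ be the random directed graph on $[n]$ in which each of the $n(n-1)$ ordered pairs of distinct vertices is an edge independently with probability $p$; "almost surely" means with probability tending to $1$ as $n\to\infty$. The fractional arboricity of $H$ is $a(H)=\max \frac{|E(H')|}{|V(H')|-1}$ over the subgraphs $H'$ of $H$ with at least two vertices, and $H$ is totally balanced if $a(H)=\frac{|E(H)|}{|V(H)|-1}$. A rooted star is a star whose center is a source or a sink. Let $H$ be the directed graph with vertices $a,b,c,d,e$ and edges $(a,b),(b,c),(c,d),(c,e),(d,e)$. Then $H$ is a dag that is not a rooted star, $a(H)=3/2$, and $H$ is not totally balanced. For every $a^*>4/3$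 there are constants $c,C>0$ such that almost surely $G\sim\vec G(n,n^{-1/a^*})$ satisfies $c\log n\le\tau(H,G)\le C\log n$, that is, $\tau(H,G)=\Theta(\log n)$. In particular, for every $a^*$ with $4/3<a^*<a(H)$, almost surely $\tau(H,G)>1$. (Thus the theorem that for every totally balanced dag $H$ that is not a rooted star and every $0<a^*<a(H)$, almost surely $\tau(H,G)\le 1$, fails without the hypothesis of total balance.) -/

import Mathlib

open MeasureTheory ProbabilityTheory Filter Topology

namespace DagCover

/-- A subgraph of a digraph: a set of vertices and a set of edges of `G` between them. -/
structure SubDigraph {V : Type*} (G : Digraph V) where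
  verts : Set V
  Adj : V → V → Prop
  adj_sub : ∀ {u v : V}, Adj u v → G.Adj u v
  fst_mem : ∀ {u v : V}, Adj u v → u ∈ verts
  snd_mem : ∀ {u v : V}, Adj u v → v ∈ verts

/-- A subgraph as a digraph on its own vertex set. -/
def SubDigraph.coe {V : Type*} {G : Digraph V} (S : SubDigraph G) : Digraph S.verts where
  Adj u v := S.Adj u v

/-- The number of vertices of a subgraph. -/
noncomputable def SubDigraph.numVerts {V : Type*} {G : Digraph V} (S : SubDigraph G) : ℕ :=
  S.verts.ncard

/-- The number of edges of a subgraph. -/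
noncomputable def SubDigraph.numEdges {V : Type*} {G : Digraph V} (S : SubDigraph G) : ℕ :=
  {e : V × V | S.Adj e.1 e.2}.ncard

/-- `S` is an `H`-copy of `G`: a subgraph of `G` that is isomorphic to `H`. -/
def IsCopy {W V : Type*} (H : Digraph W) {G : Digraph V} (S : SubDigraph G) : Prop :=
  Nonempty (H.Adj ≃r S.coe.Adj)

/-- A digraph without directed cycles (in particular without loops): a dag. -/
def IsDag {V : Type*} (G : Digraph V) : Prop :=
  ∀ v : V, ¬ Relation.TransGen G.Adj v v

/-- A rooted star: a star whose center `c` is a source (all edges go from `c` to the other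
vertices) or a sink (all edges go from the other vertices to `c`). -/
def IsRootedStar {V : Type*} (G : Digraph V) : Prop :=
  ∃ c : V, (∀ u v, G.Adj u v ↔ u = c ∧ v ≠ c) ∨ (∀ u v, G.Adj u v ↔ v = c ∧ u ≠ c)

/-- The fractional arboricity `a(H)`, the maximum of `|E(H')| / (|V(H')| - 1)` over the subgraphs
`H'` with at least two vertices. -/
noncomputable def fracArboricity {V : Type*} (H : Digraph V) : ℝ :=
  sSup {x : ℝ | ∃ S : SubDigraph H, 2 ≤ S.numVerts ∧
    x = (S.numEdges : ℝ) / ((S.numVerts : ℝ) - 1)}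

/-- `H` is totally balanced: `a(H) = |E(H)| / (|V(H)| - 1)`. -/
def IsTotallyBalanced {V : Type*} (H : Digraph V) : Prop :=
  fracArboricity H = ({e : V × V | H.Adj e.1 e.2}.ncard : ℝ) / ((Nat.card V : ℝ) - 1)

/-- The spanning subgraph `G_L(π)` of the edges `(i, j)` of `G` with `π i < π j`. -/
def leftPart {n : ℕ} (G : Digraph (Fin n)) (π : Equiv.Perm (Fin n)) : Digraph (Fin n) where
  Adj i j := G.Adj i j ∧ π i < π j

/-- `π` covers the subgraph `S` of `G`: `S` is a subgraph of `G_L(π)`. -/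
def Covers {n : ℕ} {G : Digraph (Fin n)} (π : Equiv.Perm (Fin n)) (S : SubDigraph G) : Prop :=
  ∀ u v, S.Adj u v → (leftPart G π).Adj u v

/-- There are permutations `π_1, …, π_t` such that every `H`-copy of `G` is covered by at least one
of them. -/
def HasCover {W : Type*} (H : Digraph W) {n : ℕ} (G : Digraph (Fin n)) (t : ℕ) : Prop :=
  ∃ π : Fin t → Equiv.Perm (Fin n), ∀ S : SubDigraph G, IsCopy H S → ∃ i, Covers (π i) S

/-- `τ(H, G)`, the smallest number of permutations that cover all the `H`-copies of `G`. -/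
noncomputable def tau {W : Type*} (H : Digraph W) {n : ℕ} (G : Digraph (Fin n)) : ℕ :=
  sInf {t : ℕ | HasCover H G t}

/-- A dag on `[n]` has a topological ordering. -/
theorem exists_perm_of_isDag {n : ℕ} (D : Digraph (Fin n)) (hD : IsDag D) :
    ∃ π : Equiv.Perm (Fin n), ∀ u v, D.Adj u v → π u < π v := by
  have hpo : IsPartialOrder (Fin n) (Relation.ReflTransGen D.Adj) :=
    { refl := fun _ => Relation.ReflTransGen.refl
      trans := fun _ _ _ h₁ h₂ => h₁.trans h₂
      antisymm := fun a b h₁ h₂ => by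
        rcases Relation.reflTransGen_iff_eq_or_transGen.1 h₁ with h | h
        · exact h.symm
        · exact absurd (h.trans_left h₂) (hD a) }
  obtain ⟨s, hs, hle⟩ := extend_partialOrder (Relation.ReflTransGen D.Adj)
  classical
  let rank : Fin n → ℕ := fun v => (Finset.univ.filter fun u => s u v ∧ u ≠ v).card
  have hrank : ∀ u v, s u v → u ≠ v → rank u < rank v := by
    intro u v huv hne
    refine Finset.card_lt_card (Finset.ssubset_iff_subset_ne.2 ⟨?_, ?_⟩)
    · intro w hw
      simp only [Finset.mem_filter, Finset.mem_univ, true_and] at hw ⊢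
      refine ⟨_root_.trans hw.1 huv, ?_⟩
      rintro rfl
      exact hne (antisymm huv hw.1)
    · intro h
      have hu : u ∈ Finset.univ.filter fun w => s w v ∧ w ≠ v := by simp [huv, hne]
      rw [← h] at hu
      simp at hu
  have hlt : ∀ v, rank v < n := by
    intro v
    have : (Finset.univ.filter fun u => s u v ∧ u ≠ v).card < (Finset.univ : Finset (Fin n)).card :=
      Finset.card_lt_card (Finset.filter_ssubset.2 ⟨v, Finset.mem_univ _, by simp⟩)
    simpa using this
  have hinj : Function.Injective fun v => (⟨rank v, hlt v⟩ : Fin n) := by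
    intro u v h
    by_contra hne
    have h' : rank u = rank v := congrArg Fin.val h
    rcases total_of s u v with h₁ | h₁
    · exact absurd h' (hrank u v h₁ hne).ne
    · exact absurd h' (hrank v u h₁ (Ne.symm hne)).ne'
  refine ⟨Equiv.ofBijective _ (Finite.injective_iff_bijective.1 hinj), fun u v huv => ?_⟩
  refine hrank u v (hle _ _ (Relation.ReflTransGen.single huv)) ?_
  rintro rfl
  exact hD u (Relation.TransGen.single huv)

/-- For a dag `H` the minimum that defines `τ(H, G)` exists. -/
theorem hasCover_tau {W : Type*} {H : Digraph W} (hH : IsDag H) {n : ℕ} (G : Digraph (Fin n)) :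
    HasCover H G (tau H G) := by
  refine Nat.sInf_mem (s := {t : ℕ | HasCover H G t}) ?_
  let e := Fintype.equivFin (Equiv.Perm (Fin n))
  refine ⟨Fintype.card (Equiv.Perm (Fin n)), e.symm, ?_⟩
  rintro S ⟨f⟩
  have key : ∀ u v, Relation.TransGen S.Adj u v → ∃ (hu : u ∈ S.verts) (hv : v ∈ S.verts),
      Relation.TransGen H.Adj (f.symm ⟨u, hu⟩) (f.symm ⟨v, hv⟩) := by
    intro u v h
    induction h with
    | single h =>
      refine ⟨S.fst_mem h, S.snd_mem h, Relation.TransGen.single (f.symm.map_rel_iff.2 h)⟩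
    | tail _ h ih =>
      obtain ⟨hu, hv, ih⟩ := ih
      exact ⟨hu, S.snd_mem h, ih.tail (f.symm.map_rel_iff.2 h)⟩
  obtain ⟨π, hπ⟩ := exists_perm_of_isDag (⟨S.Adj⟩ : Digraph (Fin n)) (by
    intro v hv
    obtain ⟨_, _, h⟩ := key v v hv
    exact hH _ h)
  refine ⟨e π, fun u v huv => ⟨S.adj_sub huv, ?_⟩⟩
  simpa using hπ u v huv

/-- The digraph with vertex set `[n]` and edge set `E`. -/
def ofEdges {n : ℕ} (E : Set (Fin n × Fin n)) : Digraph (Fin n) where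
  Adj u v := (u, v) ∈ E

/-- The distribution of the edge set of the random digraph `G(n, p)`: each of the `n (n - 1)`
ordered pairs of distinct vertices is an edge with probability `p`, independently. -/
noncomputable def gnp (n : ℕ) (p : unitInterval) : Measure (Set (Fin n × Fin n)) :=
  setBernoulli {e : Fin n × Fin n | e.1 ≠ e.2} p

/-- The edge probability `n ^ (-1 / a)`. It lies in `[0, 1]` for `a > 0`. -/
noncomputable def edgeProb (a : ℝ) (n : ℕ) : unitInterval :=
  Set.projIcc (0 : ℝ) 1 zero_le_one ((n : ℝ) ^ (-1 / a))

theorem coe_edgeProb {a : ℝ} (ha : 0 < a) (n : ℕ) :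
    (edgeProb a n : ℝ) = (n : ℝ) ^ (-1 / a) := by
  have hneg : -1 / a < 0 := div_neg_of_neg_of_pos (by norm_num) ha
  have h : (n : ℝ) ^ (-1 / a) ∈ Set.Icc (0 : ℝ) 1 := by
    refine ⟨by positivity, ?_⟩
    rcases Nat.eq_zero_or_pos n with rfl | hn
    · simp [Real.zero_rpow hneg.ne]
    · exact Real.rpow_le_one_of_one_le_of_nonpos (by exact_mod_cast hn) hneg.le
  rw [edgeProb, Set.projIcc_of_mem zero_le_one h]

/-- The property `P` holds asymptotically almost surely for `G ∼ G(n, p n)`. -/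
def AlmostSurely (p : ℕ → unitInterval) (P : (n : ℕ) → Digraph (Fin n) → Prop) : Prop :=
  Tendsto (fun n => gnp n (p n) {E | P n (ofEdges E)}) atTop (𝓝 1)

/-- The dag `H`, with vertices `a, b, c, d, e = 0, 1, 2, 3, 4`: a directed path `a → b → c` and a
transitive triangle on `c, d, e` with source `c`, with edges `c → d`, `c → e`, `d → e`. -/
def dagH : Digraph (Fin 5) where
  Adj u v := (u = 0 ∧ v = 1) ∨ (u = 1 ∧ v = 2) ∨ (u = 2 ∧ v = 3) ∨ (u = 2 ∧ v = 4) ∨ (u = 3 ∧ v = 4)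

end DagCover

namespace DagCover

/-! The upper bound holds for every digraph on at least three vertices. A uniformly random
5-colouring gives the vertices of a fixed labelled copy the colours of their labels with probability
at least `5⁻⁵ = 1/3125`, and a permutation that orders the colours then covers the copy. There are
at most `n ^ 5` labelled copies, so choosing good colourings greedily covers them all in `O(log n)`
rounds.

The lower bound compares two scales. At density `p = n ^ (-3/4 + γ)`, with `γ > 0` small, about
`n³p³` vertices are sources of transitive triangles, while any two disjoint sets of size a little
above `log n / p` are joined by an edge. The first number exceeds the second by a power of `n`
because `p` is above `n ^ (-3/4)`; this is the origin of `4/3`. The triangle is what makes `a(H)`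
equal to `3/2`, but obstructing a cover needs only triangle sources in abundance, not triangles at
most vertices.

Given `t` permutations, repeated halving finds sets `A`, `B` of sources, each smaller by a factor of
order `2 ^ t`, such that every permutation puts one entirely before the other. If `2 ^ t` is below
the gap between the scales, there is a path `a → b → c` with `a, c ∈ A` and `b ∈ B`. Every
permutation reverses one of its two edges, and a triangle at `c` completes it to an uncovered copy
(`not_hasCover_dagH`). The probabilistic input is `gnp_not_isTriangleRich_le`. -/

/-! ### Elementary properties of the dag. -/

theorem dagH_lt {u v : Fin 5} (h : dagH.Adj u v) : u < v := by
  rcases h with ⟨rfl, rfl⟩ | ⟨rfl, rfl⟩ | ⟨rfl, rfl⟩ | ⟨rfl, rfl⟩ | ⟨rfl, rfl⟩ <;> decide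

theorem isDag_dagH : IsDag dagH := by
  intro v hv
  have key : ∀ u w, Relation.TransGen dagH.Adj u w → u < w := by
    intro u w h
    induction h with
    | single h => exact dagH_lt h
    | tail _ h ih => exact ih.trans (dagH_lt h)
  exact lt_irrefl v (key v v hv)

theorem not_isRootedStar_dagH : ¬ IsRootedStar dagH := by
  rintro ⟨c, h | h⟩
  · have h₀ := ((h 0 1).1 (by simp [dagH])).1
    have h₁ := ((h 1 2).1 (by simp [dagH])).1
    exact absurd (h₀.trans h₁.symm) (by decide)
  · have h₀ := ((h 0 1).1 (by simp [dagH])).1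
    have h₁ := ((h 1 2).1 (by simp [dagH])).1
    exact absurd (h₀.trans h₁.symm) (by decide)

/-- The edge set of `dagH`. -/
def dagHEdges : Finset (Fin 5 × Fin 5) := {(0, 1), (1, 2), (2, 3), (2, 4), (3, 4)}

theorem mem_dagHEdges {e : Fin 5 × Fin 5} : e ∈ dagHEdges ↔ dagH.Adj e.1 e.2 := by
  obtain ⟨u, v⟩ := e
  simp [dagHEdges, dagH]

/-- The bound `|E(H')| / (|V(H')| - 1) ≤ 3/2` with denominators cleared. Induced subgraphs suffice,
since they have the most edges on a given vertex set. -/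
theorem two_mul_card_dagHEdges_le :
    ∀ s : Finset (Fin 5), 2 ≤ s.card →
      2 * (dagHEdges.filter fun e => e.1 ∈ s ∧ e.2 ∈ s).card + 3 ≤ 3 * s.card := by
  decide

theorem fracArboricity_dagH : fracArboricity dagH = 3 / 2 := by
  refine IsGreatest.csSup_eq ⟨?_, ?_⟩
  · let S : SubDigraph dagH :=
      { verts := {2, 3, 4}
        Adj := fun u v => (u, v) ∈ ({(2, 3), (2, 4), (3, 4)} : Finset (Fin 5 × Fin 5))
        adj_sub := by
          intro u v h
          simp only [Finset.mem_insert, Finset.mem_singleton, Prod.mk.injEq] at h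
          exact Or.inr (Or.inr h)
        fst_mem := by
          intro u v h
          simp only [Finset.mem_insert, Finset.mem_singleton, Prod.mk.injEq] at h
          simp only [Set.mem_insert_iff, Set.mem_singleton_iff]
          tauto
        snd_mem := by
          intro u v h
          simp only [Finset.mem_insert, Finset.mem_singleton, Prod.mk.injEq] at h
          simp only [Set.mem_insert_iff, Set.mem_singleton_iff]
          tauto }
    have hv : S.numVerts = 3 := by
      have : S.verts = ((({2, 3, 4} : Finset (Fin 5)) : Set (Fin 5))) := by simp [S]
      rw [SubDigraph.numVerts, this, Set.ncard_coe_finset]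
      decide
    have he : S.numEdges = 3 := by
      have : {e : Fin 5 × Fin 5 | S.Adj e.1 e.2} =
          ((({(2, 3), (2, 4), (3, 4)} : Finset (Fin 5 × Fin 5)) : Set (Fin 5 × Fin 5))) := by
        ext e
        simp [S]
      rw [SubDigraph.numEdges, this, Set.ncard_coe_finset]
      decide
    refine ⟨S, by omega, ?_⟩
    rw [hv, he]
    norm_num
  · rintro x ⟨S, hS, rfl⟩
    classical
    have hv : S.numVerts = S.verts.toFinset.card := by
      rw [SubDigraph.numVerts, Set.ncard_eq_toFinset_card']
    have he : S.numEdges ≤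
        (dagHEdges.filter fun e => e.1 ∈ S.verts.toFinset ∧ e.2 ∈ S.verts.toFinset).card := by
      rw [SubDigraph.numEdges, ← Set.ncard_coe_finset]
      refine Set.ncard_le_ncard (fun e he => ?_) (Finset.finite_toSet _)
      have he' : S.Adj e.1 e.2 := he
      simp only [Finset.coe_filter, Set.mem_toFinset, Set.mem_ofPred_eq]
      exact ⟨mem_dagHEdges.2 (S.adj_sub he'), S.fst_mem he', S.snd_mem he'⟩
    have hb := two_mul_card_dagHEdges_le S.verts.toFinset (hv ▸ hS)
    have h1 : 2 * S.numEdges + 3 ≤ 3 * S.numVerts := by omega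
    have h1' : 2 * (S.numEdges : ℝ) + 3 ≤ 3 * S.numVerts := by exact_mod_cast h1
    have h2' : (2 : ℝ) ≤ S.numVerts := by exact_mod_cast hS
    rw [div_le_div_iff₀ (by linarith) (by norm_num)]
    linarith

theorem not_isTotallyBalanced_dagH : ¬ IsTotallyBalanced dagH := by
  have h : {e : Fin 5 × Fin 5 | dagH.Adj e.1 e.2}.ncard = 5 := by
    have : {e : Fin 5 × Fin 5 | dagH.Adj e.1 e.2} = (dagHEdges : Set (Fin 5 × Fin 5)) := by
      ext e
      exact mem_dagHEdges.symm
    rw [this, Set.ncard_coe_finset]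
    decide
  rw [IsTotallyBalanced, fracArboricity_dagH, h, Nat.card_fin]
  norm_num


/-! ### Upper bound: random colourings. -/

/-- A colouring of the vertices extends to a permutation that orders the colours. -/
theorem exists_perm_of_coloring {n : ℕ} (f : Fin n → Fin 5) :
    ∃ π : Equiv.Perm (Fin n), ∀ u v, f u < f v → π u < π v := by
  refine exists_perm_of_isDag ⟨fun u v => f u < f v⟩ fun v hv => ?_
  have key : ∀ u w, Relation.TransGen (fun u v => f u < f v) u w → f u < f w := by
    intro u w h
    induction h with
    | single h => exact h
    | tail _ h ih => exact ih.trans h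
  exact lt_irrefl _ (key v v hv)

/-- A random colouring is rainbow on a given injective tuple with probability at least `5⁻⁵`. -/
theorem card_colorings_le {n : ℕ} (x : Fin 5 → Fin n) (hx : Function.Injective x) :
    5 ^ n ≤ 3125 * (Finset.univ.filter fun f : Fin n → Fin 5 => ∀ i, f (x i) = i).card := by
  classical
  -- Recolour `x i` by `i` and remember the old colours of the tuple. This is injective, so all
  -- colourings number at most `5 ^ 5` times the good ones.
  let r : (Fin n → Fin 5) → (Fin 5 → Fin 5) × (Fin n → Fin 5) := fun f =>
    (f ∘ x, fun v => if h : ∃ i, x i = v then h.choose else f v)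
  have hle : (Finset.univ : Finset (Fin n → Fin 5)).card ≤
      ((Finset.univ : Finset (Fin 5 → Fin 5)) ×ˢ
        Finset.univ.filter fun f : Fin n → Fin 5 => ∀ i, f (x i) = i).card := by
    refine Finset.card_le_card_of_injOn r ?_ ?_
    · intro f _
      simp only [Finset.coe_product, Set.mem_prod, Finset.coe_univ, Set.mem_univ, true_and,
        Finset.coe_filter, Finset.mem_univ, Set.mem_ofPred_eq, r]
      intro i
      have h : ∃ j, x j = x i := ⟨i, rfl⟩
      rw [dif_pos h]
      exact hx h.choose_spec
    · intro f _ g _ hfg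
      simp only [r, Prod.mk.injEq] at hfg
      ext1 v
      by_cases h : ∃ i, x i = v
      · obtain ⟨i, rfl⟩ := h
        exact congrFun hfg.1 i
      · simpa [h] using congrFun hfg.2 v
  simpa [Finset.card_product] using hle

/-- Averaging: double counting pairs of a colouring and a tuple on which it is good, some colouring
is at least as good as the mean. -/
theorem exists_coloring {n : ℕ} (X : Finset (Fin 5 → Fin n))
    (hX : ∀ x ∈ X, Function.Injective x) :
    ∃ f : Fin n → Fin 5, X.card ≤ 3125 * (X.filter fun x => ∀ i, f (x i) = i).card := by
  classical
  by_contra! hcon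
  have h1 : ∑ f : Fin n → Fin 5, 3125 * (X.filter fun x => ∀ i, f (x i) = i).card <
      ∑ _f : Fin n → Fin 5, X.card := by
    have hf : Nonempty (Fin n → Fin 5) := ⟨fun _ => 0⟩
    exact Finset.sum_lt_sum_of_nonempty Finset.univ_nonempty fun f _ => hcon f
  have h2 : ∑ f : Fin n → Fin 5, (X.filter fun x => ∀ i, f (x i) = i).card =
      ∑ x ∈ X, (Finset.univ.filter fun f : Fin n → Fin 5 => ∀ i, f (x i) = i).card := by
    simp only [Finset.card_filter]
    exact Finset.sum_comm
  rw [← Finset.mul_sum, h2, Finset.mul_sum] at h1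
  have h3 : ∑ _x ∈ X, 5 ^ n ≤
      ∑ x ∈ X, 3125 * (Finset.univ.filter fun f : Fin n → Fin 5 => ∀ i, f (x i) = i).card :=
    Finset.sum_le_sum fun x hx => card_colorings_le x (hX x hx)
  simp only [Finset.sum_const, smul_eq_mul, Finset.card_univ, Fintype.card_fun,
    Fintype.card_fin] at h1 h3
  rw [mul_comm] at h3
  exact absurd (h3.trans_lt h1) (lt_irrefl _)

/-- Greedy choice: each new permutation handles a fraction `1/3125` of the tuples that remain, and
fewer than one remaining tuple means none. -/
theorem exists_perms_of_card_lt {n : ℕ} (t : ℕ) : ∀ X : Finset (Fin 5 → Fin n),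
    (∀ x ∈ X, Function.Injective x) → (X.card : ℝ) * (1 - 1 / 3125) ^ t < 1 →
    ∃ π : Fin t → Equiv.Perm (Fin n), ∀ x ∈ X, ∃ i, ∀ j k : Fin 5, j < k →
      π i (x j) < π i (x k) := by
  classical
  induction t with
  | zero =>
    intro X _ h
    have h' : X.card = 0 := by
      rw [pow_zero, mul_one] at h
      exact Nat.lt_one_iff.1 (by exact_mod_cast h)
    refine ⟨fun i => i.elim0, fun x hx => ?_⟩
    rw [Finset.card_eq_zero] at h'
    simp [h'] at hx
  | succ t ih =>
    intro X hX h
    obtain ⟨f, hf⟩ := exists_coloring X hX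
    obtain ⟨σ, hσ⟩ := exists_perm_of_coloring f
    have hcard := Finset.card_filter_add_card_filter_not (s := X) (fun x => ∀ i, f (x i) = i)
    have hle : ((X.filter fun x => ¬ ∀ i, f (x i) = i).card : ℝ) ≤ X.card * (1 - 1 / 3125) := by
      have h1 : (X.card : ℝ) ≤ 3125 * (X.filter fun x => ∀ i, f (x i) = i).card := by
        exact_mod_cast hf
      have h2 : ((X.filter fun x => ∀ i, f (x i) = i).card : ℝ) +
          (X.filter fun x => ¬ ∀ i, f (x i) = i).card = X.card := by exact_mod_cast hcard
      linarith
    obtain ⟨π, hπ⟩ := ih (X.filter fun x => ¬ ∀ i, f (x i) = i)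
      (fun x hx => hX x (Finset.mem_filter.1 hx).1)
      (lt_of_le_of_lt (mul_le_mul_of_nonneg_right hle (by positivity)) (by
        rw [pow_succ] at h
        linarith))
    refine ⟨Fin.cons σ π, fun x hx => ?_⟩
    by_cases hxf : ∀ i, f (x i) = i
    · refine ⟨0, fun j k hjk => ?_⟩
      rw [Fin.cons_zero]
      exact hσ _ _ (by rwa [hxf, hxf])
    · obtain ⟨i, hi⟩ := hπ x (Finset.mem_filter.2 ⟨hx, hxf⟩)
      refine ⟨i.succ, ?_⟩
      rwa [Fin.cons_succ]

theorem hasCover_dagH_of_lt {n t : ℕ} (G : Digraph (Fin n))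
    (h : (n : ℝ) ^ 5 * (1 - 1 / 3125) ^ t < 1) : HasCover dagH G t := by
  classical
  obtain ⟨π, hπ⟩ := exists_perms_of_card_lt t
    (Finset.univ.filter fun x : Fin 5 → Fin n => Function.Injective x)
    (fun x hx => (Finset.mem_filter.1 hx).2) (by
      refine lt_of_le_of_lt (mul_le_mul_of_nonneg_right ?_ (by positivity)) h
      have : (Finset.univ.filter fun x : Fin 5 → Fin n => Function.Injective x).card ≤ n ^ 5 := by
        refine (Finset.card_filter_le _ _).trans ?_
        simp
      exact_mod_cast this)
  refine ⟨π, ?_⟩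
  rintro S ⟨f⟩
  obtain ⟨i, hi⟩ := hπ (fun j => (f j : Fin n)) (Finset.mem_filter.2 ⟨Finset.mem_univ _,
    Subtype.val_injective.comp f.injective⟩)
  refine ⟨i, fun u v huv => ⟨S.adj_sub huv, ?_⟩⟩
  have hadj : dagH.Adj (f.symm ⟨u, S.fst_mem huv⟩) (f.symm ⟨v, S.snd_mem huv⟩) :=
    f.symm.map_rel_iff.2 huv
  simpa using hi _ _ (dagH_lt hadj)

theorem tau_dagH_le {n : ℕ} (hn : 3 ≤ n) (G : Digraph (Fin n)) :
    (tau dagH G : ℝ) ≤ 15626 * Real.log n := by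
  have hn0 : (0 : ℝ) < n := by positivity
  have hlog : 1 ≤ Real.log n := by
    rw [Real.le_log_iff_exp_le hn0]
    have : (3 : ℝ) ≤ n := by exact_mod_cast hn
    linarith [Real.exp_one_lt_d9]
  -- Here `15625 = 5 · 3125`, so that `(1 - 1/3125) ^ t ≤ exp (-t / 3125) < n ^ (-5)`.
  set t := ⌊15625 * Real.log n⌋₊ + 1 with ht
  have ht1 : 15625 * Real.log n < t := by
    rw [ht]
    push_cast
    exact Nat.lt_floor_add_one _
  have ht2 : (t : ℝ) ≤ 15626 * Real.log n := by
    have := Nat.floor_le (a := 15625 * Real.log n) (by positivity)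
    rw [ht]
    push_cast
    linarith
  have hcov : HasCover dagH G t := by
    refine hasCover_dagH_of_lt G ?_
    have h1 : (1 - 1 / 3125 : ℝ) ^ t ≤ Real.exp (-(t / 3125)) := by
      have : (1 - 1 / 3125 : ℝ) ≤ Real.exp (-(1 / 3125)) := by
        linarith [Real.add_one_le_exp (-(1 / 3125 : ℝ))]
      calc (1 - 1 / 3125 : ℝ) ^ t ≤ Real.exp (-(1 / 3125)) ^ t :=
            pow_le_pow_left₀ (by norm_num) this t
        _ = Real.exp (-(t / 3125)) := by rw [← Real.exp_nat_mul]; congr 1; ring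
    have h2 : (n : ℝ) ^ 5 = Real.exp (5 * Real.log n) := by
      rw [mul_comm, Real.exp_mul, Real.exp_log hn0]
      norm_cast
    calc (n : ℝ) ^ 5 * (1 - 1 / 3125) ^ t
        ≤ Real.exp (5 * Real.log n) * Real.exp (-(t / 3125)) := by rw [h2]; gcongr
      _ = Real.exp (5 * Real.log n - t / 3125) := by rw [← Real.exp_add, sub_eq_add_neg]
      _ < 1 := by rw [Real.exp_lt_one_iff]; linarith
  exact le_trans (by exact_mod_cast Nat.sInf_le hcov) ht2


/-! ### Lower bound: the deterministic obstruction. -/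

theorem isCopy_of_embedding {n : ℕ} {G : Digraph (Fin n)} (x : Fin 5 → Fin n)
    (hx : Function.Injective x) (hadj : ∀ i j, dagH.Adj i j → G.Adj (x i) (x j)) :
    ∃ S : SubDigraph G, IsCopy dagH S ∧ ∀ i j, dagH.Adj i j → S.Adj (x i) (x j) := by
  let S : SubDigraph G :=
    { verts := Set.range x
      Adj := fun u v => ∃ i j, dagH.Adj i j ∧ x i = u ∧ x j = v
      adj_sub := by
        rintro _ _ ⟨i, j, h, rfl, rfl⟩
        exact hadj i j h
      fst_mem := by
        rintro _ _ ⟨i, j, h, rfl, rfl⟩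
        exact ⟨i, rfl⟩
      snd_mem := by
        rintro _ _ ⟨i, j, h, rfl, rfl⟩
        exact ⟨j, rfl⟩ }
  refine ⟨S, ⟨⟨Equiv.ofInjective x hx, ?_⟩⟩, fun i j h => ⟨i, j, h, rfl, rfl⟩⟩
  intro i j
  constructor
  · rintro ⟨i', j', h, hi, hj⟩
    rw [Equiv.ofInjective_apply] at hi hj
    rwa [hx hi, hx hj] at h
  · intro h
    exact ⟨i, j, h, rfl, rfl⟩

/-- Two disjoint sets contain halves one of which lies entirely below the other. -/
theorem exists_separated_halves {α : Type*} [DecidableEq α] (π : α → ℕ)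
    (hπ : Function.Injective π) {A B : Finset α} (hAB : Disjoint A B) {r : ℕ} (hr : 0 < r)
    (hA : 2 * r ≤ A.card) (hB : 2 * r ≤ B.card) :
    ∃ A' ⊆ A, ∃ B' ⊆ B, r ≤ A'.card ∧ r ≤ B'.card ∧
      ((∀ a ∈ A', ∀ b ∈ B', π a < π b) ∨ (∀ a ∈ A', ∀ b ∈ B', π b < π a)) := by
  have hex : ∃ j, r ≤ (A.filter fun a => π a < j).card := by
    refine ⟨A.sup π + 1, ?_⟩
    rw [Finset.filter_true_of_mem fun a ha => Nat.lt_succ_of_le (Finset.le_sup ha)]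
    omega
  classical
  -- The least threshold with `r` elements of `A` below it. If `r` elements of `B` are at or above
  -- `j`, these are the two parts. Otherwise `j = i + 1`, at least `r` elements of `A` are at or
  -- above `i` and at least `r` of `B` are at or below `i`; a tie at `i` is excluded by injectivity
  -- and disjointness.
  obtain ⟨j, hj, hmin⟩ : ∃ j, r ≤ (A.filter fun a => π a < j).card ∧
      ∀ i < j, (A.filter fun a => π a < i).card < r :=
    ⟨Nat.find hex, Nat.find_spec hex, fun i hi => not_le.1 (Nat.find_min hex hi)⟩
  by_cases hBj : r ≤ (B.filter fun b => ¬ π b < j).card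
  · refine ⟨_, Finset.filter_subset _ _, _, Finset.filter_subset _ _, hj, hBj, Or.inl ?_⟩
    intro a ha b hb
    exact (Finset.mem_filter.1 ha).2.trans_le (not_lt.1 (Finset.mem_filter.1 hb).2)
  · have hBcard := Finset.card_filter_add_card_filter_not (s := B) fun b => π b < j
    obtain ⟨i, rfl⟩ : ∃ i, j = i + 1 := by
      refine Nat.exists_eq_succ_of_ne_zero ?_
      rintro rfl
      simp at hj
      omega
    have hAcard := Finset.card_filter_add_card_filter_not (s := A) fun a => π a < i
    have hlt := hmin i (Nat.lt_succ_self i)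
    refine ⟨A.filter fun a => ¬ π a < i, Finset.filter_subset _ _,
      B.filter fun b => π b < i + 1, Finset.filter_subset _ _, by omega, by omega, Or.inr ?_⟩
    intro a ha b hb
    rw [Finset.mem_filter] at ha hb
    have hne : π b ≠ π a := fun h =>
      Finset.disjoint_left.1 hAB ha.1 (hπ h ▸ hb.1)
    omega

/-- Each permutation costs a factor of two, and a separation already achieved passes to subsets. -/
theorem exists_separated {n : ℕ} {r : ℕ} (hr : 0 < r) (t : ℕ) :
    ∀ (π : Fin t → Equiv.Perm (Fin n)) (A B : Finset (Fin n)), Disjoint A B →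
      2 ^ t * r ≤ A.card → 2 ^ t * r ≤ B.card →
      ∃ A' ⊆ A, ∃ B' ⊆ B, r ≤ A'.card ∧ r ≤ B'.card ∧ ∀ i,
        ((∀ a ∈ A', ∀ b ∈ B', π i a < π i b) ∨ (∀ a ∈ A', ∀ b ∈ B', π i b < π i a)) := by
  induction t with
  | zero =>
    intro π A B _ hA hB
    exact ⟨A, subset_rfl, B, subset_rfl, by simpa using hA, by simpa using hB, fun i => i.elim0⟩
  | succ t ih =>
    intro π A B hAB hA hB
    rw [pow_succ] at hA hB
    obtain ⟨A₁, hA₁, B₁, hB₁, hcA, hcB, hsep⟩ := exists_separated_halves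
      (fun a => ((π 0 a : Fin n) : ℕ)) (Fin.val_injective.comp (π 0).injective) hAB
      (r := 2 ^ t * r) (by positivity) (by linarith) (by linarith)
    obtain ⟨A₂, hA₂, B₂, hB₂, hcA₂, hcB₂, hsep₂⟩ := ih (fun i => π i.succ) A₁ B₁
      (Finset.disjoint_of_subset_left hA₁ (Finset.disjoint_of_subset_right hB₁ hAB)) hcA hcB
    refine ⟨A₂, hA₂.trans hA₁, B₂, hB₂.trans hB₁, hcA₂, hcB₂, fun i => ?_⟩
    refine Fin.cases ?_ hsep₂ i
    rcases hsep with h | h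
    · exact Or.inl fun a ha b hb => h a (hA₂ ha) b (hB₂ hb)
    · exact Or.inr fun a ha b hb => h a (hA₂ ha) b (hB₂ hb)

/-- If many vertices are the source of a transitive triangle, and any two large sets are joined by
an edge, then few permutations cannot cover all copies. -/
theorem not_hasCover_dagH {n : ℕ} (G : Digraph (Fin n)) {t l : ℕ} (hl : 0 < l)
    (X T : Finset (Fin n)) (hTX : T ⊆ X) (hT : 4 * (2 ^ t * l) ≤ T.card)
    (htri : ∀ c ∈ T, ∃ d e, d ∉ X ∧ e ∉ X ∧ d ≠ e ∧ G.Adj c d ∧ G.Adj c e ∧ G.Adj d e)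
    (hedge : ∀ A B : Finset (Fin n), A ⊆ X → B ⊆ X → Disjoint A B → A.card = l → B.card = l →
      ∃ a ∈ A, ∃ b ∈ B, G.Adj a b) :
    ¬ HasCover dagH G t := by
  classical
  rintro ⟨π, hπ⟩
  obtain ⟨P, hPT, hP⟩ := Finset.exists_subset_card_eq (s := T) (n := 2 ^ t * (2 * l)) (by linarith)
  obtain ⟨A, hAP, B, hBT, hA, hB, hsep⟩ := exists_separated (r := 2 * l) (by omega) t π P (T \ P)
    Finset.disjoint_sdiff hP.ge (by
      rw [Finset.card_sdiff_of_subset hPT, hP]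
      have : 2 ^ t * (2 * l) + 2 ^ t * (2 * l) = 4 * (2 ^ t * l) := by ring
      omega)
  have hAT : A ⊆ T := hAP.trans hPT
  have hBT' : B ⊆ T := hBT.trans Finset.sdiff_subset
  have hdisj : Disjoint A B :=
    Finset.disjoint_of_subset_left hAP (Finset.disjoint_of_subset_right hBT Finset.disjoint_sdiff)
  -- Disjoint parts of `A` for the endpoints `a ∈ A₁` and `c ∈ C` of the path, so that `a ≠ c`.
  obtain ⟨A₁, hA₁, hA₁c⟩ := Finset.exists_subset_card_eq (s := A) (n := l) (by omega)
  obtain ⟨C, hC, hCc⟩ := Finset.exists_subset_card_eq (s := A \ A₁) (n := l) (by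
    rw [Finset.card_sdiff_of_subset hA₁]
    omega)
  have hCA : C ⊆ A := hC.trans Finset.sdiff_subset
  have hA₁C : Disjoint A₁ C := Finset.disjoint_of_subset_right hC Finset.disjoint_sdiff
  -- Otherwise `l` vertices of `B` would send no edge to the `l`-set `C`. So `l` possible midpoints
  -- remain, and an edge from `A₁` enters them.
  have hB₁ : l ≤ (B.filter fun b => ∃ c ∈ C, G.Adj b c).card := by
    by_contra! hlt
    have hcard := Finset.card_filter_add_card_filter_not (s := B) fun b => ∃ c ∈ C, G.Adj b c
    obtain ⟨D, hD, hDc⟩ := Finset.exists_subset_card_eq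
      (s := B.filter fun b => ¬ ∃ c ∈ C, G.Adj b c) (n := l) (by omega)
    have hDB : D ⊆ B := hD.trans (Finset.filter_subset _ _)
    obtain ⟨b, hb, c, hc, hbc⟩ := hedge D C ((hDB.trans hBT').trans hTX) ((hCA.trans hAT).trans hTX)
      (Finset.disjoint_of_subset_left hDB
        (Finset.disjoint_of_subset_right hCA hdisj.symm)) hDc hCc
    exact (Finset.mem_filter.1 (hD hb)).2 ⟨c, hc, hbc⟩
  obtain ⟨D, hD, hDc⟩ := Finset.exists_subset_card_eq hB₁
  have hDB : D ⊆ B := hD.trans (Finset.filter_subset _ _)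
  obtain ⟨a, ha, b, hb, hab⟩ := hedge A₁ D ((hA₁.trans hAT).trans hTX) ((hDB.trans hBT').trans hTX)
    (Finset.disjoint_of_subset_left hA₁ (Finset.disjoint_of_subset_right hDB hdisj)) hA₁c hDc
  obtain ⟨c, hc, hbc⟩ := (Finset.mem_filter.1 (hD hb)).2
  obtain ⟨d, e, hd, he, hde, hcd, hce, hde'⟩ := htri c (hAT (hCA hc))
  have haA := hA₁ ha
  have hbB := hDB hb
  have hcA := hCA hc
  have haX := hTX (hAT haA)
  have hbX := hTX (hBT' hbB)
  have hcX := hTX (hAT hcA)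
  have hab' : a ≠ b := fun h => Finset.disjoint_left.1 hdisj haA (h ▸ hbB)
  have hcb' : c ≠ b := fun h => Finset.disjoint_left.1 hdisj hcA (h ▸ hbB)
  have hac' : a ≠ c := fun h => Finset.disjoint_left.1 hA₁C ha (h ▸ hc)
  have hX : ∀ {v w}, v ∈ X → w ∉ X → v ≠ w := fun hv hw h => hw (h ▸ hv)
  have hinj : Function.Injective ![a, b, c, d, e] := by
    have := hX haX hd
    have := hX hbX hd
    have := hX hcX hd
    have := hX haX he
    have := hX hbX he
    have := hX hcX he
    intro i j hij
    fin_cases i <;> fin_cases j <;> simp at hij ⊢ <;> simp_all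
  obtain ⟨S, hS, hSadj⟩ := isCopy_of_embedding (G := G) ![a, b, c, d, e] hinj (by
    rintro i j (⟨rfl, rfl⟩ | ⟨rfl, rfl⟩ | ⟨rfl, rfl⟩ | ⟨rfl, rfl⟩ | ⟨rfl, rfl⟩) <;> assumption)
  obtain ⟨i, hi⟩ := hπ S hS
  have h₁ := (hi _ _ (hSadj 0 1 (Or.inl ⟨rfl, rfl⟩))).2
  have h₂ := (hi _ _ (hSadj 1 2 (Or.inr (Or.inl ⟨rfl, rfl⟩)))).2
  change π i a < π i b at h₁
  change π i b < π i c at h₂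
  -- If `A` precedes `B`, the edge `(b, c)` is reversed; if `B` precedes `A`, the edge `(a, b)` is.
  rcases hsep i with h | h
  · exact lt_asymm h₂ (h c hcA b hbB)
  · exact lt_asymm h₁ (h a haA b hbB)


/-! ### Independence in random sets. -/

section Bernoulli

variable {ι : Type*}

theorem setBernoulli_cylinder (u : Set ι) (p : unitInterval) (S A : Finset ι) :
    setBernoulli u p {E | ∀ i ∈ S, (i ∈ E ↔ i ∈ A)} =
      ∏ i ∈ S, ((unitInterval.toNNReal p • Measure.dirac (i ∈ u) +
        unitInterval.toNNReal (unitInterval.symm p) • Measure.dirac False : Measure Prop)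
          {q : Prop | q ↔ i ∈ A}) := by
  rw [setBernoulli_apply', ← Measure.infinitePi_pi _ fun i _ => MeasurableSet.of_discrete]
  congr 1

theorem setBernoulli_disjoint (u : Set ι) (p : unitInterval) (S : Finset ι)
    (hS : ∀ i ∈ S, i ∈ u) :
    setBernoulli u p {E | ∀ i ∈ S, i ∉ E} =
      (unitInterval.toNNReal (unitInterval.symm p) : ENNReal) ^ S.card := by
  have h := setBernoulli_cylinder u p S ∅
  simp only [Finset.notMem_empty, iff_false] at h
  rw [h, ← Finset.prod_const]
  refine Finset.prod_congr rfl fun i hi => ?_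
  have hi' : (i ∈ u) = True := eq_true (hS i hi)
  rw [hi', Measure.add_apply, Measure.smul_apply, Measure.smul_apply,
    Measure.dirac_apply' _ MeasurableSet.of_discrete,
    Measure.dirac_apply' _ MeasurableSet.of_discrete, Set.indicator_of_notMem (by simp),
    Set.indicator_of_mem (by simp)]
  simp [ENNReal.smul_def]

theorem setBernoulli_inter_cylinder [DecidableEq ι] (u : Set ι) (p : unitInterval) {S S' A : Finset ι}
    (hSS' : Disjoint S S') (hA : A ⊆ S) :
    setBernoulli u p ({E | ∀ i ∈ S, (i ∈ E ↔ i ∈ A)} ∩ {E | ∀ i ∈ S', i ∉ E}) =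
      setBernoulli u p {E | ∀ i ∈ S, (i ∈ E ↔ i ∈ A)} * setBernoulli u p {E | ∀ i ∈ S', i ∉ E} := by
  have hA' : ∀ i ∈ S', i ∉ A := fun i hi hiA => Finset.disjoint_left.1 hSS' (hA hiA) hi
  have h₁ : ({E : Set ι | ∀ i ∈ S, (i ∈ E ↔ i ∈ A)} ∩ {E | ∀ i ∈ S', i ∉ E}) =
      {E | ∀ i ∈ S ∪ S', (i ∈ E ↔ i ∈ A)} := by
    ext E
    simp only [Set.mem_inter_iff, Set.mem_ofPred_eq, Finset.mem_union, or_imp, forall_and]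
    refine and_congr_right fun _ => forall₂_congr fun i hi => ?_
    simp [hA' i hi]
  have h₂ : {E : Set ι | ∀ i ∈ S', i ∉ E} = {E | ∀ i ∈ S', (i ∈ E ↔ i ∈ A)} := by
    ext E
    refine forall₂_congr fun i hi => ?_
    simp [hA' i hi]
  rw [h₁, h₂, setBernoulli_cylinder, setBernoulli_cylinder, setBernoulli_cylinder,
    Finset.prod_union hSS']

/-- If a random set of coordinates is determined by the coordinates outside it, then it is avoided
with the probability of avoiding a fixed set of the same size. -/
theorem setBernoulli_avoid_le [Finite ι] (u : Set ι) (p : unitInterval) (S : Finset ι)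
    (f : Set ι → Finset ι) (hf : ∀ E E' : Set ι, (∀ i ∈ S, (i ∈ E ↔ i ∈ E')) → f E = f E')
    (hfS : ∀ E, Disjoint S (f E)) (hfu : ∀ E, ∀ i ∈ f E, i ∈ u) (s : ℕ) :
    setBernoulli u p {E | s ≤ (f E).card ∧ ∀ i ∈ f E, i ∉ E} ≤
      (unitInterval.toNNReal (unitInterval.symm p) : ENNReal) ^ s := by
  classical
  set μ := setBernoulli u p
  set q := (unitInterval.toNNReal (unitInterval.symm p) : ENNReal)
  have hq : q ≤ 1 := ENNReal.coe_le_one_iff.2 (unitInterval.symm p).2.2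
  -- The possible traces of `E` on `S` for which the avoided set is large. Given the trace the
  -- avoided set is fixed and lies off `S`, hence is independent of the trace; the cylinders are
  -- disjoint, so their probabilities sum to at most `1`.
  let I := S.powerset.filter fun A : Finset ι => s ≤ (f (A : Set ι)).card
  let cyl : Finset ι → Set (Set ι) := fun A => {E | ∀ i ∈ S, (i ∈ E ↔ i ∈ A)}
  have hsub : {E | s ≤ (f E).card ∧ ∀ i ∈ f E, i ∉ E} ⊆
      ⋃ A ∈ I, cyl A ∩ {E | ∀ i ∈ f (A : Set ι), i ∉ E} := by
    rintro E ⟨hs, hE⟩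
    have heq : f E = f ((S.filter fun i => i ∈ E : Finset ι) : Set ι) := by
      refine hf _ _ fun i hi => ?_
      simp [hi]
    simp only [Set.mem_iUnion]
    refine ⟨S.filter fun i => i ∈ E, ?_, ?_, ?_⟩
    · rw [Finset.mem_filter, Finset.mem_powerset, ← heq]
      exact ⟨Finset.filter_subset _ _, hs⟩
    · intro i hi
      simp [hi]
    · rw [← heq]
      exact hE
  have hdisj : (I : Set (Finset ι)).PairwiseDisjoint cyl := by
    intro A hA A' hA' hne
    refine Set.disjoint_left.2 fun E hE hE' => hne ?_
    have hAS := Finset.mem_powerset.1 (Finset.mem_filter.1 hA).1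
    have hAS' := Finset.mem_powerset.1 (Finset.mem_filter.1 hA').1
    ext i
    constructor
    · exact fun hi => (hE' i (hAS hi)).1 ((hE i (hAS hi)).2 hi)
    · exact fun hi => (hE i (hAS' hi)).1 ((hE' i (hAS' hi)).2 hi)
  calc μ {E | s ≤ (f E).card ∧ ∀ i ∈ f E, i ∉ E}
      ≤ μ (⋃ A ∈ I, cyl A ∩ {E | ∀ i ∈ f (A : Set ι), i ∉ E}) := measure_mono hsub
    _ ≤ ∑ A ∈ I, μ (cyl A ∩ {E | ∀ i ∈ f (A : Set ι), i ∉ E}) := measure_biUnion_finset_le _ _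
    _ ≤ ∑ A ∈ I, μ (cyl A) * q ^ s := by
        refine Finset.sum_le_sum fun A hA => ?_
        obtain ⟨hAS, hAs⟩ := Finset.mem_filter.1 hA
        rw [setBernoulli_inter_cylinder u p (hfS _) (Finset.mem_powerset.1 hAS),
          setBernoulli_disjoint u p _ (hfu _)]
        exact mul_le_mul' le_rfl (pow_le_pow_right_of_le_one' hq hAs)
    _ = μ (⋃ A ∈ I, cyl A) * q ^ s := by
        rw [← Finset.sum_mul, measure_biUnion_finset hdisj fun A _ => (Set.toFinite _).measurableSet]
    _ ≤ q ^ s := mul_le_of_le_one_left' prob_le_one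

end Bernoulli

theorem symm_pow_le {p : unitInterval} {q : ℝ} (hq : q ≤ p) (s : ℕ) :
    (unitInterval.toNNReal (unitInterval.symm p) : ENNReal) ^ s ≤
      ENNReal.ofReal (Real.exp (-(q * s))) := by
  have h : (unitInterval.toNNReal (unitInterval.symm p) : ENNReal) = ENNReal.ofReal (1 - p) := by
    rw [ENNReal.ofReal, ENNReal.coe_inj]
    ext
    rw [Real.coe_toNNReal _ (by linarith [p.2.2])]
    rfl
  rw [h, ← ENNReal.ofReal_pow (by linarith [p.2.2])]
  refine ENNReal.ofReal_le_ofReal ?_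
  calc (1 - (p : ℝ)) ^ s ≤ Real.exp (-q) ^ s :=
        pow_le_pow_left₀ (by linarith [p.2.2]) (by linarith [Real.add_one_le_exp (-q)]) s
    _ = Real.exp (-(q * s)) := by rw [← Real.exp_nat_mul]; congr 1; ring

/-! ### Triangle sources in the random digraph. -/

/-- Union bound for the absence of edges between two sets, one of them encoded by a set of size
`y`. -/
theorem gnp_exists_no_edge_le {n : ℕ} {p : unitInterval} {q : ℝ} (hq : q ≤ p)
    (h : Finset (Fin n) → Finset (Fin n)) (d y s : ℕ) (hq0 : 0 ≤ q) :
    gnp n p {E | ∃ D Q : Finset (Fin n), D.card = d ∧ Q.card = y ∧ Disjoint D (h Q) ∧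
      s ≤ (h Q).card ∧ ∀ v ∈ D, ∀ w ∈ h Q, (v, w) ∉ E} ≤
      ENNReal.ofReal ((n : ℝ) ^ d * (n : ℝ) ^ y * Real.exp (-(q * (d * s)))) := by
  classical
  let I := (Finset.powersetCard d (Finset.univ : Finset (Fin n)) ×ˢ
    Finset.powersetCard y (Finset.univ : Finset (Fin n))).filter
      fun z => Disjoint z.1 (h z.2) ∧ s ≤ (h z.2).card
  have hI : (I.card : ℝ) ≤ (n : ℝ) ^ d * (n : ℝ) ^ y := by
    have : I.card ≤ n ^ d * n ^ y := by
      refine (Finset.card_filter_le _ _).trans ?_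
      rw [Finset.card_product, Finset.card_powersetCard, Finset.card_powersetCard,
        Finset.card_univ, Fintype.card_fin]
      exact Nat.mul_le_mul (Nat.choose_le_pow n d) (Nat.choose_le_pow n y)
    exact_mod_cast this
  calc _ ≤ gnp n p (⋃ z ∈ I, {E | ∀ e ∈ z.1 ×ˢ h z.2, e ∉ E}) := by
        refine measure_mono ?_
        rintro E ⟨D, Q, hD, hQ, hdis, hs, hE⟩
        simp only [Set.mem_iUnion]
        refine ⟨(D, Q), ?_, ?_⟩
        · simp [I, Finset.mem_powersetCard, hD, hQ, hdis, hs]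
        · rintro ⟨v, w⟩ he
          rw [Finset.mem_product] at he
          exact hE v he.1 w he.2
    _ ≤ ∑ z ∈ I, gnp n p {E | ∀ e ∈ z.1 ×ˢ h z.2, e ∉ E} := measure_biUnion_finset_le _ _
    _ ≤ ∑ _z ∈ I, ENNReal.ofReal (Real.exp (-(q * (d * s)))) := by
        refine Finset.sum_le_sum fun z hz => ?_
        simp only [I, Finset.mem_filter, Finset.mem_product, Finset.mem_powersetCard] at hz
        rw [gnp, setBernoulli_disjoint]
        · refine (symm_pow_le hq _).trans (ENNReal.ofReal_le_ofReal (Real.exp_le_exp.2 ?_))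
          rw [Finset.card_product, hz.1.1.2]
          have : (s : ℝ) ≤ (h z.2).card := by exact_mod_cast hz.2.2
          push_cast
          gcongr
        · rintro ⟨v, w⟩ he
          rw [Finset.mem_product] at he
          exact fun hvw => Finset.disjoint_left.1 hz.2.1 he.1 (hvw ▸ he.2)
    _ ≤ _ := by
        rw [Finset.sum_const, nsmul_eq_mul, ← ENNReal.ofReal_natCast,
          ← ENNReal.ofReal_mul (by positivity)]
        exact ENNReal.ofReal_le_ofReal (by gcongr)


/-- There are at least `k` sources of transitive triangles in a set `X` in which any two disjoint
`l`-sets are joined by an edge, the triangles having their other vertices outside `X`. -/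
def IsTriangleRich {n : ℕ} (G : Digraph (Fin n)) (k l : ℕ) : Prop :=
  ∃ X T : Finset (Fin n), T ⊆ X ∧ k ≤ T.card ∧
    (∀ c ∈ T, ∃ d e, d ∉ X ∧ e ∉ X ∧ d ≠ e ∧ G.Adj c d ∧ G.Adj c e ∧ G.Adj d e) ∧
    ∀ A B : Finset (Fin n), A ⊆ X → B ⊆ X → Disjoint A B → A.card = l → B.card = l →
      ∃ a ∈ A, ∃ b ∈ B, G.Adj a b

theorem card_filter_val_lt {n a b : ℕ} (hb : b ≤ n) :
    (Finset.univ.filter fun v : Fin n => a ≤ (v : ℕ) ∧ (v : ℕ) < b).card = b - a := by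
  rw [← Nat.card_Ico a b, ← Finset.card_map Fin.valEmbedding]
  congr 1
  ext v
  simp only [Finset.mem_map, Finset.mem_filter, Finset.mem_univ, true_and, Fin.valEmbedding_apply,
    Finset.mem_Ico]
  exact ⟨fun ⟨w, hw, h⟩ => h ▸ hw, fun h => ⟨⟨v, by omega⟩, h, rfl⟩⟩

theorem card_filter_gt_of_no_missing {V : Type*} [DecidableEq V] {Z : Finset V} {P : V → Prop}
    [DecidablePred P] {y : ℕ} (hy : y ≤ Z.card)
    (h : ∀ Q ⊆ Z, Q.card = y → ∃ w ∈ Z \ Q, P w) : y < (Z.filter P).card := by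
  by_contra! hle
  obtain ⟨Q, hQ, hQZ, hQc⟩ := Finset.exists_subsuperset_card_eq (Finset.filter_subset P Z) hle hy
  obtain ⟨w, hw, hP⟩ := h Q hQZ hQc
  rw [Finset.mem_sdiff] at hw
  exact hw.2 (hQ (Finset.mem_filter.2 ⟨hw.1, hP⟩))

/-- In the random digraph, a set `X₀` of size `s` contains the source of a transitive triangle
with high probability, given that the second out-neighbourhoods of its vertices are large. -/
theorem gnp_no_triangle_le {n : ℕ} {p : unitInterval} {q : ℝ} (hq : q ≤ p)
    (X₀ Y Z : Finset (Fin n)) (hXY : Disjoint X₀ Y) (hXZ : Disjoint X₀ Z) (hYZ : Disjoint Y Z)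
    (y : ℕ) :
    gnp n p {E | (∀ c ∈ X₀, ∃ Q ⊆ Z, y ≤ Q.card ∧ ∀ e ∈ Q, ∃ d ∈ Y, (c, d) ∈ E ∧ (d, e) ∈ E) ∧
      ∀ c ∈ X₀, ∀ d ∈ Y, ∀ e ∈ Z, (c, d) ∈ E → (d, e) ∈ E → (c, e) ∉ E} ≤
      ENNReal.ofReal (Real.exp (-(q * (X₀.card * y : ℕ)))) := by
  classical
  -- The pairs that would close a path `c → d → e` to a triangle. They are determined by the edges
  -- from `X₀` to `Y` and from `Y` to `Z`, while they lie in `X₀ ×ˢ Z`, so they can be exposed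
  -- afterwards.
  let f : Set (Fin n × Fin n) → Finset (Fin n × Fin n) := fun E =>
    (X₀ ×ˢ Z).filter fun z => ∃ d ∈ Y, (z.1, d) ∈ E ∧ (d, z.2) ∈ E
  let S : Finset (Fin n × Fin n) := X₀ ×ˢ Y ∪ Y ×ˢ Z
  have hmem : ∀ E c e, (c, e) ∈ f E ↔
      (c ∈ X₀ ∧ e ∈ Z) ∧ ∃ d ∈ Y, (c, d) ∈ E ∧ (d, e) ∈ E := by
    intro E c e
    simp [f]
  refine le_trans (measure_mono ?_) ((setBernoulli_avoid_le _ p S f ?_ ?_ ?_ (X₀.card * y)).trans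
    (symm_pow_le hq _))
  · rintro E ⟨hE, hno⟩
    constructor
    · have hcard : (f E).card =
          ∑ c ∈ X₀, (Z.filter fun e => ∃ d ∈ Y, (c, d) ∈ E ∧ (d, e) ∈ E).card := by
        simp only [f, Finset.card_filter]
        rw [Finset.sum_product]
      rw [hcard, ← smul_eq_mul]
      refine Finset.card_nsmul_le_sum _ _ _ fun c hc => ?_
      obtain ⟨Q, hQZ, hQ, hQE⟩ := hE c hc
      exact hQ.trans (Finset.card_le_card fun e he =>
        Finset.mem_filter.2 ⟨hQZ he, hQE e he⟩)
    · rintro ⟨c, e⟩ hz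
      obtain ⟨⟨hc, he⟩, d, hd, hcd, hde⟩ := (hmem E c e).1 hz
      exact hno c hc d hd e he hcd hde
  · intro E E' hEE'
    ext ⟨c, e⟩
    rw [hmem, hmem]
    refine and_congr_right fun ⟨hc, he⟩ => exists_congr fun d => and_congr_right fun hd => ?_
    rw [hEE' (c, d) (by simp [S, hc, hd]), hEE' (d, e) (by simp [S, hd, he])]
  · intro E
    refine Finset.disjoint_left.2 ?_
    rintro ⟨c, e⟩ hS hz
    obtain ⟨⟨hc, he⟩, -⟩ := (hmem E c e).1 hz
    simp only [S, Finset.mem_union, Finset.mem_product] at hS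
    rcases hS with h | h
    · exact Finset.disjoint_left.1 hYZ h.2 he
    · exact Finset.disjoint_left.1 hXY hc h.1
  · rintro E ⟨c, e⟩ hz
    obtain ⟨⟨hc, he⟩, -⟩ := (hmem E c e).1 hz
    intro h
    have h' : c = e := h
    exact Finset.disjoint_left.1 hXZ hc (h' ▸ he)

/-- Triangles `c → d → e` are sought with `c`, `d`, `e` in three disjoint intervals `X`, `Y`, `Z` of
length `m`. Cutting `k` blocks of size `s` from `X` and finding a source in each gives `k` distinct
sources. The four terms bound the four ways to fail. -/
theorem gnp_not_isTriangleRich_le {n : ℕ} {p : unitInterval} {q : ℝ} (hq : q ≤ p) (hq0 : 0 ≤ q)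
    {m x y l s k : ℕ} (hm : 3 * m ≤ n) (hx : x ≤ m) (hy : y ≤ m) (hks : k * s ≤ m) :
    gnp n p {E | ¬ IsTriangleRich (ofEdges E) k l} ≤
      ENNReal.ofReal ((n : ℝ) ^ 1 * (n : ℝ) ^ x * Real.exp (-(q * ((1 : ℕ) * (m - x : ℕ))))) +
      ENNReal.ofReal ((n : ℝ) ^ x * (n : ℝ) ^ y * Real.exp (-(q * (x * (m - y : ℕ))))) +
      ENNReal.ofReal ((n : ℝ) ^ l * (n : ℝ) ^ l * Real.exp (-(q * (l * l)))) +
      ENNReal.ofReal (k * Real.exp (-(q * (s * y : ℕ)))) := by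
  classical
  set X := Finset.univ.filter fun v : Fin n => 0 ≤ (v : ℕ) ∧ (v : ℕ) < m with hX
  set Y := Finset.univ.filter fun v : Fin n => m ≤ (v : ℕ) ∧ (v : ℕ) < 2 * m with hY
  set Z := Finset.univ.filter fun v : Fin n => 2 * m ≤ (v : ℕ) ∧ (v : ℕ) < 3 * m with hZ
  let X₀ : ℕ → Finset (Fin n) := fun j =>
    Finset.univ.filter fun v : Fin n => j * s ≤ (v : ℕ) ∧ (v : ℕ) < (j + 1) * s
  have hYc : Y.card = m := by
    rw [hY, card_filter_val_lt (by omega)]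
    omega
  have hZc : Z.card = m := by
    rw [hZ, card_filter_val_lt (by omega)]
    omega
  have hmX : ∀ v, v ∈ X ↔ (v : ℕ) < m := fun v => by simp [hX]
  have hmY : ∀ v, v ∈ Y ↔ m ≤ (v : ℕ) ∧ (v : ℕ) < 2 * m := fun v => by simp [hY]
  have hmZ : ∀ v, v ∈ Z ↔ 2 * m ≤ (v : ℕ) ∧ (v : ℕ) < 3 * m := fun v => by simp [hZ]
  have hXY : Disjoint X Y := Finset.disjoint_left.2 fun v h h' => by
    rw [hmX] at h; rw [hmY] at h'; omega
  have hXZ : Disjoint X Z := Finset.disjoint_left.2 fun v h h' => by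
    rw [hmX] at h; rw [hmZ] at h'; omega
  have hYZ : Disjoint Y Z := Finset.disjoint_left.2 fun v h h' => by
    rw [hmY] at h; rw [hmZ] at h'; omega
  have hblock : ∀ j < k, (j + 1) * s ≤ m := fun j hj =>
    (Nat.mul_le_mul_right s hj).trans hks
  have hX₀c : ∀ j < k, (X₀ j).card = s := fun j hj => by
    have := hblock j hj
    rw [card_filter_val_lt (by omega), add_mul, one_mul, Nat.add_sub_cancel_left]
  have hX₀X : ∀ j < k, X₀ j ⊆ X := fun j hj v hv => by
    rw [hmX]
    exact (Finset.mem_filter.1 hv).2.2.trans_le (hblock j hj)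
  -- `B₁`: a vertex with at most `x` out-neighbours in `Y`. `B₂`: an `x`-set with at most `y`
  -- out-neighbours in `Z`. In both, `Q` contains the neighbours, so the union bound pays only for
  -- the small set. `B₃`: two disjoint `l`-sets with no edge from the first to the second. `B₄ j`:
  -- block `j` has large second out-neighbourhoods but no triangle source.
  let B₁ : Set (Set (Fin n × Fin n)) := {E | ∃ D Q : Finset (Fin n), D.card = 1 ∧ Q.card = x ∧
    Disjoint D (Y \ Q) ∧ m - x ≤ (Y \ Q).card ∧ ∀ v ∈ D, ∀ w ∈ Y \ Q, (v, w) ∉ E}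
  let B₂ : Set (Set (Fin n × Fin n)) := {E | ∃ D Q : Finset (Fin n), D.card = x ∧ Q.card = y ∧
    Disjoint D (Z \ Q) ∧ m - y ≤ (Z \ Q).card ∧ ∀ v ∈ D, ∀ w ∈ Z \ Q, (v, w) ∉ E}
  let B₃ : Set (Set (Fin n × Fin n)) := {E | ∃ D Q : Finset (Fin n), D.card = l ∧ Q.card = l ∧
    Disjoint D Q ∧ l ≤ Q.card ∧ ∀ v ∈ D, ∀ w ∈ Q, (v, w) ∉ E}
  let B₄ : ℕ → Set (Set (Fin n × Fin n)) := fun j =>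
    {E | (∀ c ∈ X₀ j, ∃ Q ⊆ Z, y ≤ Q.card ∧ ∀ e ∈ Q, ∃ d ∈ Y, (c, d) ∈ E ∧ (d, e) ∈ E) ∧
      ∀ c ∈ X₀ j, ∀ d ∈ Y, ∀ e ∈ Z, (c, d) ∈ E → (d, e) ∈ E → (c, e) ∉ E}
  have hsub : {E | ¬ IsTriangleRich (ofEdges E) k l} ⊆
      B₁ ∪ B₂ ∪ B₃ ∪ ⋃ j ∈ Finset.range k, B₄ j := by
    intro E hE
    by_contra hcon
    simp only [Set.mem_union, Set.mem_iUnion, not_or, not_exists] at hcon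
    obtain ⟨⟨⟨h₁, h₂⟩, h₃⟩, h₄⟩ := hcon
    refine hE ⟨X, X.filter fun c => ∃ d ∈ Y, ∃ e ∈ Z, (c, d) ∈ E ∧ (d, e) ∈ E ∧ (c, e) ∈ E,
      Finset.filter_subset _ _, ?_, ?_, ?_⟩
    · have hsecond : ∀ c ∈ X, ∃ Q ⊆ Z, y ≤ Q.card ∧
          ∀ e ∈ Q, ∃ d ∈ Y, (c, d) ∈ E ∧ (d, e) ∈ E := by
        intro c hc
        have hN : x < (Y.filter fun d => (c, d) ∈ E).card := by
          refine card_filter_gt_of_no_missing (by omega) fun Q hQ hQc => ?_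
          by_contra! hno
          refine h₁ ⟨{c}, Q, Finset.card_singleton c, hQc, ?_, ?_, ?_⟩
          · exact Finset.disjoint_of_subset_left (Finset.singleton_subset_iff.2 hc)
              (Finset.disjoint_of_subset_right Finset.sdiff_subset hXY)
          · rw [Finset.card_sdiff_of_subset hQ, hYc, hQc]
          · intro v hv w hw
            rw [Finset.mem_singleton.1 hv]
            exact hno w hw
        obtain ⟨D, hD, hDc⟩ := Finset.exists_subset_card_eq hN.le
        have hN₂ : y < (Z.filter fun e => ∃ d ∈ D, (d, e) ∈ E).card := by
          refine card_filter_gt_of_no_missing (by omega) fun Q hQ hQc => ?_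
          by_contra! hno
          refine h₂ ⟨D, Q, hDc, hQc, ?_, ?_, fun v hv w hw => hno w hw v hv⟩
          · exact Finset.disjoint_of_subset_left (hD.trans (Finset.filter_subset _ _))
              (Finset.disjoint_of_subset_right Finset.sdiff_subset hYZ)
          · rw [Finset.card_sdiff_of_subset hQ, hZc, hQc]
        refine ⟨_, Finset.filter_subset _ _, hN₂.le, fun e he => ?_⟩
        obtain ⟨d, hd, hde⟩ := (Finset.mem_filter.1 he).2
        exact ⟨d, (Finset.mem_filter.1 (hD hd)).1, (Finset.mem_filter.1 (hD hd)).2, hde⟩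
      -- Division by `s` recovers the index of the block, so sources in distinct blocks are
      -- distinct.
      have himg : Finset.range k ⊆ (X.filter fun c => ∃ d ∈ Y, ∃ e ∈ Z,
          (c, d) ∈ E ∧ (d, e) ∈ E ∧ (c, e) ∈ E).image fun v : Fin n => (v : ℕ) / s := by
        intro j hj
        have hjk := Finset.mem_range.1 hj
        by_contra hno
        refine h₄ j hj ⟨fun c hc => hsecond c (hX₀X j hjk hc), ?_⟩
        intro c hc d hd e he hcd hde hce
        refine hno (Finset.mem_image.2 ⟨c, Finset.mem_filter.2
          ⟨hX₀X j hjk hc, d, hd, e, he, hcd, hde, hce⟩, ?_⟩)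
        obtain ⟨hc₁, hc₂⟩ := (Finset.mem_filter.1 hc).2
        exact Nat.div_eq_of_lt_le hc₁ hc₂
      simpa using (Finset.card_le_card himg).trans Finset.card_image_le
    · intro c hc
      obtain ⟨-, d, hd, e, he, hcd, hde, hce⟩ := Finset.mem_filter.1 hc
      exact ⟨d, e, Finset.disjoint_right.1 hXY hd, Finset.disjoint_right.1 hXZ he,
        fun h => Finset.disjoint_left.1 hYZ hd (h ▸ he), hcd, hce, hde⟩
    · intro A B _ _ hAB hA hB
      by_contra! hno
      exact h₃ ⟨A, B, hA, hB, hAB, hB.ge, hno⟩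
  refine (measure_mono hsub).trans ((measure_union_le _ _).trans (add_le_add
    ((measure_union_le _ _).trans (add_le_add ((measure_union_le _ _).trans (add_le_add
      ?_ ?_)) ?_)) ?_))
  · exact gnp_exists_no_edge_le hq (fun Q => Y \ Q) 1 x (m - x) hq0
  · exact gnp_exists_no_edge_le hq (fun Q => Z \ Q) x y (m - y) hq0
  · exact gnp_exists_no_edge_le hq (fun Q => Q) l l l hq0
  · refine (measure_biUnion_finset_le _ _).trans ?_
    rw [ENNReal.ofReal_mul (by positivity), ENNReal.ofReal_natCast, ← nsmul_eq_mul]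
    conv_rhs => rw [← Finset.card_range k]
    refine Finset.sum_le_card_nsmul _ _ _ fun j hj => ?_
    have hjk := Finset.mem_range.1 hj
    have := gnp_no_triangle_le hq (X₀ j) Y Z
      (Finset.disjoint_of_subset_left (hX₀X j hjk) hXY)
      (Finset.disjoint_of_subset_left (hX₀X j hjk) hXZ) hYZ y
    rwa [hX₀c j hjk] at this


/-! ### Choice of the sizes. -/

theorem exists_nat_between {r : ℝ} (hr : 1 ≤ r) : ∃ k : ℕ, 0 < k ∧ r ≤ k ∧ (k : ℝ) ≤ 2 * r :=
  ⟨⌈r⌉₊, Nat.ceil_pos.2 (by linarith), Nat.le_ceil r, by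
    linarith [Nat.ceil_lt_add_one (by linarith : (0 : ℝ) ≤ r)]⟩

set_option maxHeartbeats 1000000 in
/-- Integer sizes for the sets in `gnp_not_isTriangleRich_le`, for `n = w ^ 4`, edge probability
`u ^ 4 / w ^ 3` and `L = log n`. -/
theorem exists_sizes {n : ℕ} {u w L : ℝ} (hL : 1 ≤ L) (hu : 1000 ≤ u) (huL : 1000 * L ≤ u)
    (hw : 1000 * u ^ 4 ≤ w) (hn : (n : ℝ) = w ^ 4) :
    ∃ m x y l s k : ℕ, 3 * m ≤ n ∧ x ≤ m ∧ y ≤ m ∧ k * s ≤ m ∧ 0 < l ∧ k ≤ n ∧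
      4 * u * l ≤ k ∧
      (1 + x) * L - u ^ 4 / w ^ 3 * (1 * (m - x : ℕ)) ≤ -L ∧
      (x + y) * L - u ^ 4 / w ^ 3 * (x * (m - y : ℕ)) ≤ -L ∧
      (l + l) * L - u ^ 4 / w ^ 3 * (l * l) ≤ -L ∧
      L - u ^ 4 / w ^ 3 * (s * y : ℕ) ≤ -L := by
  have hu0 : 0 < u := by linarith
  have hu2 : 1000 ≤ u ^ 2 := by nlinarith
  have hu4 : 1000 ≤ u ^ 4 := by nlinarith
  have hw1 : 1000 ≤ w := by nlinarith
  have hw0 : 0 < w := by linarith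
  have hw2 : 1000 ≤ w ^ 2 := by nlinarith
  have huw : 1000 * u ^ 2 ≤ w := by nlinarith
  -- With `q = u ^ 4 / w ^ 3`, each size leaves a power of `u` to beat `L`: typical out-degrees are
  -- of order `nq = w u ^ 4` against `x ≈ w u ^ 2`; an `x`-set reaches about `x n q = w ^ 2 u ^ 6`
  -- vertices against `y ≈ w ^ 2 u ^ 4`; `l ≈ w ^ 3 / u ^ 2` gives `q l ≥ u ^ 2`; and `s ≈ w / u ^
  -- 4` gives `q s y ≥ u ^ 4`.
  obtain ⟨x, hx0, hx1, hx2⟩ := exists_nat_between (r := w * u ^ 2) (by nlinarith)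
  obtain ⟨y, hy0, hy1, hy2⟩ := exists_nat_between (r := w ^ 2 * u ^ 4) (by nlinarith)
  obtain ⟨l, hl0, hl1, hl2⟩ := exists_nat_between (r := w ^ 3 / u ^ 2) (by
    rw [le_div_iff₀ (by positivity)]
    nlinarith)
  obtain ⟨s, hs0, hs1, hs2⟩ := exists_nat_between (r := w / u ^ 4) (by
    rw [le_div_iff₀ (by positivity)]
    linarith)
  have hm1 : w ^ 4 / 4 ≤ (n / 3 : ℕ) := by
    have h : n < 3 * (n / 3) + 3 := by omega
    have h' : (n : ℝ) < 3 * (n / 3 : ℕ) + 3 := by exact_mod_cast h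
    have : 1000 ≤ w ^ 4 := by nlinarith
    linarith
  set m := n / 3 with hm
  have hxm : 2 * (x : ℝ) ≤ m := by
    have : w * u ^ 2 * 1000 ≤ w ^ 2 * w ^ 2 := by
      calc w * u ^ 2 * 1000 = w * (1000 * u ^ 2) := by ring
        _ ≤ w * w := by gcongr
        _ ≤ w ^ 2 * w ^ 2 := by nlinarith
    nlinarith
  have hym : 2 * (y : ℝ) ≤ m := by
    have : w ^ 2 * u ^ 4 * 1000 ≤ w ^ 4 := by
      calc w ^ 2 * u ^ 4 * 1000 = w ^ 2 * (1000 * u ^ 4) := by ring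
        _ ≤ w ^ 2 * w := by gcongr
        _ ≤ w ^ 2 * w ^ 2 := by nlinarith
        _ = w ^ 4 := by ring
    nlinarith
  have hxm' : x ≤ m := by
    have : (x : ℝ) ≤ m := by linarith [(Nat.cast_nonneg x : (0 : ℝ) ≤ x)]
    exact_mod_cast this
  have hym' : y ≤ m := by
    have : (y : ℝ) ≤ m := by linarith [(Nat.cast_nonneg y : (0 : ℝ) ≤ y)]
    exact_mod_cast this
  have hx1' : (1 : ℝ) ≤ x := by exact_mod_cast hx0
  have hy1' : (1 : ℝ) ≤ y := by exact_mod_cast hy0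
  have hl1' : (1 : ℝ) ≤ l := by exact_mod_cast hl0
  have hs0' : (0 : ℝ) < s := by exact_mod_cast hs0
  have hLu : L ≤ u / 1000 := by linarith
  -- The number of blocks is of order `w ^ 3 u ^ 4`, well above the required `4 u l`, which is at
  -- most `8 w ^ 3 / u`.
  refine ⟨m, x, y, l, s, m / s, by omega, hxm', hym', Nat.div_mul_le_self m s, hl0,
    (Nat.div_le_self m s).trans (by omega), ?_, ?_, ?_, ?_, ?_⟩
  · have h1 : (m : ℝ) < ((m / s : ℕ) + 1) * s := by exact_mod_cast Nat.lt_mul_of_div_lt (Nat.lt_succ_self (m / s)) hs0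
    have h2 : w ^ 4 / 4 < ((m / s : ℕ) + 1) * (2 * (w / u ^ 4)) :=
      (hm1.trans_lt h1).trans_le (by gcongr)
    have h3 : w ^ 3 * u ^ 4 / 8 < (m / s : ℕ) + 1 := by
      have : ((m / s : ℕ) + 1 : ℝ) * (2 * (w / u ^ 4)) = ((m / s : ℕ) + 1) * (2 * w) / u ^ 4 := by
        ring
      rw [this, lt_div_iff₀ (by positivity)] at h2
      refine lt_of_mul_lt_mul_right ?_ (by positivity : 0 ≤ 2 * w)
      linarith [show w ^ 3 * u ^ 4 / 8 * (2 * w) = w ^ 4 / 4 * u ^ 4 by ring]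
    have h4 : 4 * u * l ≤ 8 * w ^ 3 / u := by
      calc 4 * u * l ≤ 4 * u * (2 * (w ^ 3 / u ^ 2)) := by gcongr
        _ = 8 * w ^ 3 / u := by field_simp; ring
    have h5 : 8 * w ^ 3 / u ≤ w ^ 3 := by
      rw [div_le_iff₀ hu0]
      have h6 : w ^ 3 * 1000 ≤ w ^ 3 * u := by gcongr
      have : 0 < w ^ 3 := by positivity
      linarith
    have h6 : 1 ≤ w ^ 3 := one_le_pow₀ (by linarith)
    have h7 : w ^ 3 * 1000 ≤ w ^ 3 * u ^ 4 := by gcongr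
    linarith
  · have h1 : w ^ 4 / 8 ≤ (m - x : ℕ) := by
      rw [Nat.cast_sub hxm']
      linarith
    have h2 : u ^ 4 / w ^ 3 * (w ^ 4 / 8) ≤ u ^ 4 / w ^ 3 * (m - x : ℕ) := by gcongr
    have h3 : u ^ 4 / w ^ 3 * (w ^ 4 / 8) = u ^ 4 * w / 8 := by field_simp
    have h4 : (2 + x) * L ≤ 6 * (w * u ^ 2) * (u / 1000) := by
      calc (2 + x) * L ≤ 6 * (w * u ^ 2) * L := by gcongr; linarith
        _ ≤ _ := by gcongr
    have h5 : 6 * (w * u ^ 2) * (u / 1000) ≤ u ^ 4 * w / 8 := by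
      have h6 : w * u ^ 3 * 1000 ≤ w * u ^ 3 * u := by gcongr
      have : 0 < w * u ^ 3 := by positivity
      linarith [show w * u ^ 3 * u = u ^ 4 * w by ring,
        show 6 * (w * u ^ 2) * (u / 1000) = 6 / 1000 * (w * u ^ 3) by ring]
    linarith
  · have hxy : (x : ℝ) ≤ 2 * (w ^ 2 * u ^ 4) := by
      refine hx2.trans ?_
      have : w * u ^ 2 ≤ w ^ 2 * u ^ 4 :=
        mul_le_mul (by nlinarith) (by nlinarith) (by positivity) (by positivity)
      linarith
    have h1 : w ^ 4 / 8 ≤ (m - y : ℕ) := by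
      rw [Nat.cast_sub hym']
      linarith
    have h2 : u ^ 4 / w ^ 3 * (w * u ^ 2 * (w ^ 4 / 8)) ≤ u ^ 4 / w ^ 3 * (x * (m - y : ℕ)) := by
      gcongr
    have h3 : u ^ 4 / w ^ 3 * (w * u ^ 2 * (w ^ 4 / 8)) = w ^ 2 * u ^ 6 / 8 := by
      field_simp
    have h4 : (x + y + 1) * L ≤ 6 * (w ^ 2 * u ^ 4) * (u / 1000) := by
      calc (x + y + 1) * L ≤ 6 * (w ^ 2 * u ^ 4) * L := by gcongr; linarith
        _ ≤ _ := by gcongr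
    have h5 : 6 * (w ^ 2 * u ^ 4) * (u / 1000) ≤ w ^ 2 * u ^ 6 / 8 := by
      have h6 : w ^ 2 * u ^ 5 * 1000 ≤ w ^ 2 * u ^ 5 * u := by gcongr
      have : 0 < w ^ 2 * u ^ 5 := by positivity
      linarith [show w ^ 2 * u ^ 5 * u = w ^ 2 * u ^ 6 by ring,
        show 6 * (w ^ 2 * u ^ 4) * (u / 1000) = 6 / 1000 * (w ^ 2 * u ^ 5) by ring]
    linarith
  · have h1 : u ^ 2 * l ≤ u ^ 4 / w ^ 3 * (l * l) := by
      calc u ^ 2 * l = u ^ 4 / w ^ 3 * (w ^ 3 / u ^ 2 * l) := by field_simp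
        _ ≤ _ := by gcongr
    have h2 : (l + l + 1) * L ≤ u ^ 2 * l := by
      calc (l + l + 1) * L ≤ (3 * l) * (u / 1000) := by gcongr; linarith
        _ ≤ u ^ 2 * l := by nlinarith [mul_pos hu0 (by linarith : (0 : ℝ) < l)]
    linarith
  · have h1 : u ^ 4 ≤ u ^ 4 / w ^ 3 * (s * y : ℕ) := by
      push_cast
      calc u ^ 4 = u ^ 4 / w ^ 3 * (w / u ^ 4 * (w ^ 2 * u ^ 4)) := by field_simp
        _ ≤ _ := by gcongr
    have h2 : u ≤ u ^ 4 := le_self_pow₀ (by linarith) (by norm_num)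
    linarith

theorem eventually_gnp_not_isTriangleRich_le {γ : ℝ} (hγ : 0 < γ) (hγ' : γ ≤ 1 / 12) :
    ∀ᶠ n : ℕ in atTop, ∃ k l : ℕ, 0 < l ∧ 4 * (n : ℝ) ^ (γ / 4) * l ≤ k ∧
      ∀ p : unitInterval, (n : ℝ) ^ (-(3 / 4 - γ)) ≤ p →
        gnp n p {E | ¬ IsTriangleRich (ofEdges E) k l} ≤ ENNReal.ofReal (4 / n) := by
  have hlog : Tendsto (fun n : ℕ => Real.log n) atTop atTop :=
    Real.tendsto_log_atTop.comp tendsto_natCast_atTop_atTop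
  have hpow : Tendsto (fun n : ℕ => (n : ℝ) ^ (γ / 4)) atTop atTop :=
    (tendsto_rpow_atTop (by positivity)).comp tendsto_natCast_atTop_atTop
  have hlittle : ∀ᶠ n : ℕ in atTop, 1000 * Real.log n ≤ (n : ℝ) ^ (γ / 4) := by
    have h := (isLittleO_log_rpow_atTop (by positivity : 0 < γ / 4)).bound
      (by norm_num : (0 : ℝ) < 1 / 1000)
    filter_upwards [tendsto_natCast_atTop_atTop.eventually h, eventually_ge_atTop 1] with n hn hn1
    rw [Real.norm_of_nonneg (Real.log_natCast_nonneg n), Real.norm_of_nonneg (by positivity)] at hn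
    linarith
  filter_upwards [hlog.eventually_ge_atTop 1, hpow.eventually_ge_atTop 1000, hlittle,
    eventually_ge_atTop 1] with n hn1 hn2 hn3 hn4
  have hn0 : (0 : ℝ) < n := by exact_mod_cast hn4
  have hn1' : (1 : ℝ) ≤ n := by exact_mod_cast hn4
  set u := (n : ℝ) ^ (γ / 4) with hu
  set w := (n : ℝ) ^ (1 / 4 : ℝ) with hw
  have hw4 : (n : ℝ) = w ^ 4 := by
    rw [hw, ← Real.rpow_natCast, ← Real.rpow_mul hn0.le]
    norm_num
  have huw : 1000 * u ^ 4 ≤ w := by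
    -- This is where `γ ≤ 1 / 12` enters: `u ^ 12 = n ^ (3γ)` and `w = n ^ (1/4)`.
    have h1 : u ^ 12 ≤ w := by
      rw [hu, hw, ← Real.rpow_natCast, ← Real.rpow_mul hn0.le]
      refine Real.rpow_le_rpow_of_exponent_le hn1' ?_
      push_cast
      linarith
    have h2 : 1000 ≤ u ^ 8 := hn2.trans (le_self_pow₀ (by linarith) (by norm_num))
    calc 1000 * u ^ 4 ≤ u ^ 8 * u ^ 4 := by gcongr
      _ = u ^ 12 := by ring
      _ ≤ w := h1
  have hq : (n : ℝ) ^ (-(3 / 4 - γ)) = u ^ 4 / w ^ 3 := by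
    rw [hu, hw, ← Real.rpow_natCast, ← Real.rpow_natCast, ← Real.rpow_mul hn0.le,
      ← Real.rpow_mul hn0.le, ← Real.rpow_sub hn0]
    congr 1
    push_cast
    ring
  obtain ⟨m, x, y, l, s, k, hm, hx, hy, hks, hl, hkn, hkl, h1, h2, h3, h4⟩ :=
    exists_sizes hn1 hn2 hn3 huw hw4
  refine ⟨k, l, hl, hkl, fun p hp => ?_⟩
  rw [hq] at hp
  have hnexp : ∀ j : ℕ, (n : ℝ) ^ j = Real.exp (j * Real.log n) := fun j => by
    rw [Real.exp_nat_mul, Real.exp_log hn0]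
  have hninv : Real.exp (-Real.log n) = 1 / n := by
    rw [Real.exp_neg, Real.exp_log hn0, one_div]
  -- The inequalities between the sizes are logarithms of bounds by `1 / n` on the four failure
  -- probabilities.
  have key : ∀ (i j : ℕ) (z : ℝ), (i + j) * Real.log n - z ≤ -Real.log n →
      (n : ℝ) ^ i * (n : ℝ) ^ j * Real.exp (-z) ≤ 1 / n := by
    intro i j z h
    rw [hnexp, hnexp, ← Real.exp_add, ← Real.exp_add, ← hninv]
    refine Real.exp_le_exp.2 ?_
    linarith
  refine (gnp_not_isTriangleRich_le hp (by positivity) hm hx hy hks).trans ?_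
  have hsum : ENNReal.ofReal (4 / n) = ENNReal.ofReal (1 / n) + ENNReal.ofReal (1 / n) +
      ENNReal.ofReal (1 / n) + ENNReal.ofReal (1 / n) := by
    rw [← ENNReal.ofReal_add (by positivity) (by positivity),
      ← ENNReal.ofReal_add (by positivity) (by positivity),
      ← ENNReal.ofReal_add (by positivity) (by positivity)]
    congr 1
    ring
  rw [hsum]
  refine add_le_add (add_le_add (add_le_add ?_ ?_) ?_) ?_ <;> refine ENNReal.ofReal_le_ofReal ?_
  · exact key 1 x _ (by exact_mod_cast h1)
  · exact key x y _ h2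
  · exact key l l _ h3
  · have h5 := key 1 0 (u ^ 4 / w ^ 3 * (s * y : ℕ)) (by push_cast at h4 ⊢; linarith)
    refine le_trans ?_ h5
    have : (k : ℝ) ≤ n := by exact_mod_cast hkn
    simp only [pow_one, pow_zero, mul_one]
    gcongr

/-! ### Almost sure conclusions. -/

/-- A property that holds up to an event of vanishing probability holds almost surely. -/
theorem almostSurely_of_compl_le {p : ℕ → unitInterval} {P : (n : ℕ) → Digraph (Fin n) → Prop}
    {ε : ℕ → ENNReal} (hε : Tendsto ε atTop (𝓝 0))
    (h : ∀ᶠ n in atTop, gnp n (p n) {E | ¬ P n (ofEdges E)} ≤ ε n) : AlmostSurely p P := by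
  have hlim : Tendsto (fun n => 1 - ε n) atTop (𝓝 1) := by
    simpa using ENNReal.Tendsto.sub tendsto_const_nhds hε (Or.inl ENNReal.one_ne_top)
  have hprob : ∀ n, IsProbabilityMeasure (gnp n (p n)) := fun n => by
    unfold gnp
    infer_instance
  refine tendsto_of_tendsto_of_tendsto_of_le_of_le' hlim tendsto_const_nhds ?_
    (Eventually.of_forall fun n => prob_le_one)
  filter_upwards [h] with n hn
  rw [tsub_le_iff_right]
  calc (1 : ENNReal) = gnp n (p n) Set.univ := measure_univ.symm
    _ ≤ gnp n (p n) ({E | P n (ofEdges E)} ∪ {E | ¬ P n (ofEdges E)}) :=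
        measure_mono fun E _ => em _
    _ ≤ _ := (measure_union_le _ _).trans (add_le_add le_rfl hn)

theorem AlmostSurely.mono {p : ℕ → unitInterval} {P Q : (n : ℕ) → Digraph (Fin n) → Prop}
    (hP : AlmostSurely p P) (h : ∀ᶠ n in atTop, ∀ G, P n G → Q n G) : AlmostSurely p Q := by
  have hprob : ∀ n, IsProbabilityMeasure (gnp n (p n)) := fun n => by
    unfold gnp
    infer_instance
  refine tendsto_of_tendsto_of_tendsto_of_le_of_le' hP tendsto_const_nhds ?_
    (Eventually.of_forall fun n => prob_le_one)
  filter_upwards [h] with n hn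
  exact measure_mono fun E hE => hn _ hE

/-- If `τ < γ log n`, then `2 ^ τ ≤ exp τ ≤ n ^ γ`, so there are enough sources to halve `τ` times
and a cover by `τ` permutations is impossible. -/
theorem IsTriangleRich.le_tau {n k l : ℕ} {γ : ℝ} (hn : 1 ≤ n) (hl : 0 < l)
    (hkl : 4 * (n : ℝ) ^ γ * l ≤ k) {G : Digraph (Fin n)} (hG : IsTriangleRich G k l) :
    γ * Real.log n ≤ tau dagH G := by
  by_contra! hlt
  obtain ⟨X, T, hTX, hk, htri, hedge⟩ := hG
  refine not_hasCover_dagH G (t := tau dagH G) hl X T hTX ?_ htri hedge (hasCover_tau isDag_dagH G)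
  refine le_trans ?_ hk
  have hn0 : (0 : ℝ) < n := by exact_mod_cast hn
  have h2 : (2 : ℝ) ^ tau dagH G ≤ (n : ℝ) ^ γ := by
    calc (2 : ℝ) ^ tau dagH G ≤ Real.exp 1 ^ tau dagH G :=
          pow_le_pow_left₀ (by norm_num) (by linarith [Real.add_one_le_exp 1]) _
      _ = Real.exp (tau dagH G) := by rw [← Real.exp_nat_mul, mul_one]
      _ ≤ Real.exp (Real.log n * γ) := Real.exp_le_exp.2 (by linarith)
      _ = (n : ℝ) ^ γ := (Real.rpow_def_of_pos hn0 γ).symm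
  have h3 : (4 * (2 ^ tau dagH G * l) : ℝ) ≤ k := by
    refine le_trans ?_ hkl
    rw [← mul_assoc]
    gcongr
  exact_mod_cast h3

theorem exists_almostSurely_tau_log {a : ℝ} (ha : 4 / 3 < a) :
    ∃ c C : ℝ, 0 < c ∧ 0 < C ∧ AlmostSurely (edgeProb a) fun n G =>
      c * Real.log n ≤ (tau dagH G : ℝ) ∧ (tau dagH G : ℝ) ≤ C * Real.log n := by
  have ha0 : 0 < a := by linarith
  have hinv : 1 / a < 3 / 4 := by
    rw [div_lt_div_iff₀ ha0 (by norm_num)]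
    linarith
  -- Positive exactly because `a > 4 / 3`. The second entry makes the edge probability at least `n ^
  -- (-(3/4 - γ))`; the cap handles denser digraphs through the same lower bound on the density.
  set γ := min (1 / 12) (3 / 4 - 1 / a) with hγ
  have hγ0 : 0 < γ := lt_min (by norm_num) (by linarith)
  refine ⟨γ / 4, 15626, by positivity, by norm_num, ?_⟩
  refine almostSurely_of_compl_le (ε := fun n => ENNReal.ofReal (4 / n)) ?_ ?_
  · have := ENNReal.tendsto_ofReal (tendsto_const_div_atTop_nhds_zero_nat (4 : ℝ))
    simpa using this
  · filter_upwards [eventually_gnp_not_isTriangleRich_le hγ0 (min_le_left _ _),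
      eventually_ge_atTop 3] with n hn hn3
    obtain ⟨k, l, hl, hkl, hbound⟩ := hn
    refine (measure_mono ?_).trans (hbound (edgeProb a n) ?_)
    · exact fun E hE hrich =>
        hE ⟨IsTriangleRich.le_tau (by omega) hl hkl hrich, tau_dagH_le hn3 _⟩
    · rw [coe_edgeProb ha0]
      refine Real.rpow_le_rpow_of_exponent_le (by exact_mod_cast (by omega : 1 ≤ n)) ?_
      have := min_le_right (1 / 12) (3 / 4 - 1 / a)
      rw [neg_div]
      linarith

end DagCover

theorem proposition6 :
    DagCover.IsDag DagCover.dagH ∧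
    ¬ DagCover.IsRootedStar DagCover.dagH ∧
    DagCover.fracArboricity DagCover.dagH = 3 / 2 ∧
    ¬ DagCover.IsTotallyBalanced DagCover.dagH ∧
    (∀ a : ℝ, 4 / 3 < a → ∃ c C : ℝ, 0 < c ∧ 0 < C ∧
      DagCover.AlmostSurely (DagCover.edgeProb a) (fun n G =>
        c * Real.log n ≤ (DagCover.tau DagCover.dagH G : ℝ) ∧
        (DagCover.tau DagCover.dagH G : ℝ) ≤ C * Real.log n)) ∧
    (∀ a : ℝ, 4 / 3 < a → a < DagCover.fracArboricity DagCover.dagH →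
      DagCover.AlmostSurely (DagCover.edgeProb a) (fun _ G =>
        1 < DagCover.tau DagCover.dagH G)) := by
  refine ⟨DagCover.isDag_dagH, DagCover.not_isRootedStar_dagH, DagCover.fracArboricity_dagH,
    DagCover.not_isTotallyBalanced_dagH, fun a ha => DagCover.exists_almostSurely_tau_log ha,
    fun a ha _ => ?_⟩
  obtain ⟨c, C, hc, -, h⟩ := DagCover.exists_almostSurely_tau_log ha
  have hlog : Tendsto (fun n : ℕ => c * Real.log n) atTop atTop :=
    (Real.tendsto_log_atTop.comp tendsto_natCast_atTop_atTop).const_mul_atTop hc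
  refine h.mono ?_
  filter_upwards [hlog.eventually_gt_atTop 1] with n hn G hG
  exact_mod_cast hn.trans_le hG.1
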